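/- Let $\mathcal U_i,\mathcal X_i,\mathcal Y_i$ ($i=1,2$) be finite alphabets, let $p_{\rm s}$ be a probability distribution on $\mathcal U_1\times\mathcal U_2$, let $p(y_1,y_2|x_1,x_2)$ be the transition probabilities of a memoryless two-way channel with inputs $x_i\in\mathcal X_i$ and outputs $y_i\in\mathcal Y_i$, let $d_i:\mathcal U_i\times\mathcal U_i\to\mathbb R$ be distortion measures, and let $r>0$ and $D_1,D_2$ be real numbers. A code with $K$ source symbols and $N\ge 1$ channel uses consists of encoders $f_{in}:\mathcal U_i^K\times\mathcal Y_i^{n-1}\to\mathcal X_i$ ($i=1,2$, $1\le n\le N$) and decoders $g_i:\mathcal U_i^K\times\mathcal Y_i^N\to\mathcal U_j^K$ ($j\ne i$). With $X_{in}=f_{in}(U_i^K,Y_i^{n-1})$, the joint distribution of sources and channel outputs is $$p(u_1^K,u_2^K,y_1^N,y_2^N)=\prod_{m=1}^K p_{\rm s}(u_{1m},u_{2m})\prod_{n=1}^N p(y_{1n},y_{2n}|x_{1n},x_{2n}),$$ the estimate of $U_j^K$ is $\hat U_j^K=g_i(U_i^K,Y_i^N)$, and the expected distortions are $D_{f_i}=K^{-1}\sum_{m=1}^K\mathbb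 E[d_i(U_{im},\hat U_{im})]$. The pair $(D_1,D_2)$ is achievable at rate $r$ if there are codes, one for each $K$, with $K$ source symbols and $N_K$ channel uses such that $K/N_K\to r$ and $\limsup_{K\to\infty}D_{f_i}\le D_i$ for $i=1,2$. Let $$R^{(i)}(D)=\inf\{I(U_i;\hat U_i): p(\hat u_i|u_i)\text{ a conditional distribution on }\mathcal U_i\text{ with }\mathbb E[d_i(U_i,\hat U_i)]\le D\}$$ be the rate-distortion function of $U_i$, where $(U_1,U_2)\sim p_{\rm s}$ (and $\inf\emptyset=+\infty$). If $(D_1,D_2)$ is achievable at rate $r$, then there is a probability distribution $p(x_1,x_2)$ on $\mathcal X_1\times\mathcal X_2$ such that both $$R^{(1)}(D_1)\le I(U_1;U_2)+r^{-1}I(X_1;Y_2|X_2)\quad\text{and}\quad R^{(2)}(D_2)\le I(U_1;U_2)+r^{-1}I(X_2;Y_1|X_1),$$ where $(U_1,U_2)\sim p_{\rm s}$ and $(X_1,X_2,Y_1,Y_2)\sim p(x_1,x_2)\,p(y_1,y_2|x_1,x_2)$, and $(U_1,U_2)$ is independent of $(X_1,X_2)$. -/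

import Mathlib

noncomputable section

open scoped Classical in
/-- The probability mass function of the random variable `X` when the outcomes in the finite
sample space `Ω` have the probabilities `q`. -/
def TWC.law {Ω α : Type*} [Fintype Ω] (q : Ω → ℝ) (X : Ω → α) (a : α) : ℝ :=
  ∑ ω : Ω, if X ω = a then q ω else 0

/-- Mutual information `I(X;Y)` (in nats) of finite-valued random variables `X`, `Y` on the finite
probability space `(Ω, q)`. Terms of probability zero vanish. -/
def TWC.mutualInfo {Ω α β : Type*} [Fintype Ω] [Fintype α] [Fintype β]
    (q : Ω → ℝ) (X : Ω → α) (Y : Ω → β) : ℝ :=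
  ∑ a : α, ∑ b : β, TWC.law q (fun ω => (X ω, Y ω)) (a, b) *
    Real.log (TWC.law q (fun ω => (X ω, Y ω)) (a, b) / (TWC.law q X a * TWC.law q Y b))

/-- Conditional mutual information `I(X;Y|Z)` (in nats) of finite-valued random variables on the
finite probability space `(Ω, q)`, that is, the expectation of
`log (p(X,Y,Z) p(Z) / (p(X,Z) p(Y,Z)))`. Terms of probability zero vanish. -/
def TWC.condMutualInfo {Ω α β γ : Type*} [Fintype Ω] [Fintype α] [Fintype β] [Fintype γ]
    (q : Ω → ℝ) (X : Ω → α) (Y : Ω → β) (Z : Ω → γ) : ℝ :=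
  ∑ a : α, ∑ b : β, ∑ c : γ, TWC.law q (fun ω => (X ω, Y ω, Z ω)) (a, b, c) *
    Real.log (TWC.law q (fun ω => (X ω, Y ω, Z ω)) (a, b, c) * TWC.law q Z c /
      (TWC.law q (fun ω => (X ω, Z ω)) (a, c) * TWC.law q (fun ω => (Y ω, Z ω)) (b, c)))

/-- The rate-distortion function `R(D)` of a source with distribution `pU` on the finite alphabet
`U` and distortion measure `d`: the infimum of `I(U;Û)` over all conditional distributions
`V u û = p(û|u)` with `E[d(U,Û)] ≤ D`. It is `⊤` if no conditional distribution meets the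
distortion constraint. -/
def TWC.rateDistortion {U : Type*} [Fintype U] (pU : U → ℝ) (d : U → U → ℝ) (D : ℝ) : EReal :=
  ⨅ (V : U → U → ℝ) (_ : ∀ u, V u ∈ stdSimplex ℝ U)
    (_ : ∑ u : U, ∑ v : U, pU u * V u v * d u v ≤ D),
    ((TWC.mutualInfo (fun w : U × U => pU w.1 * V w.1 w.2) Prod.fst Prod.snd : ℝ) : EReal)

/-- The joint distribution of `((X₁, X₂), (Y₁, Y₂))` when the pair of inputs with distribution `p`
is sent over the two-way channel with transition probabilities `W x y = p(y₁, y₂ | x₁, x₂)`. -/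
def TWC.inputOutput {X₁ X₂ Y₁ Y₂ : Type*} (p : X₁ × X₂ → ℝ) (W : X₁ × X₂ → Y₁ × Y₂ → ℝ) :
    (X₁ × X₂) × (Y₁ × Y₂) → ℝ :=
  fun w => p w.1 * W w.1 w.2

/-- A two-way source-channel code with `K` source symbols and `N` channel uses at each terminal.
The input of a terminal at time `n` (times are numbered from `0`) is a function of its own
source sequence and of the `n` channel outputs that it received before. Each terminal estimates
the source sequence of the other one from its own source sequence and all its channel outputs. -/
structure TWC.Code (U₁ U₂ X₁ X₂ Y₁ Y₂ : Type*) (K N : ℕ) where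
  enc₁ : (n : Fin N) → (Fin K → U₁) → (Fin (n : ℕ) → Y₁) → X₁
  enc₂ : (n : Fin N) → (Fin K → U₂) → (Fin (n : ℕ) → Y₂) → X₂
  dec₁ : (Fin K → U₁) → (Fin N → Y₁) → (Fin K → U₂)
  dec₂ : (Fin K → U₂) → (Fin N → Y₂) → (Fin K → U₁)

/-- The outputs received before time `n`. -/
def TWC.past {Y : Type*} {N : ℕ} (y : Fin N → Y) (n : Fin N) : Fin (n : ℕ) → Y :=
  fun j => y (Fin.castLE n.isLt.le j)

/-- Outcomes of a transmission: the source sequences `(u₁, u₂)` and the output sequences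
`(y₁, y₂)`. The input sequences are functions of these. -/
abbrev TWC.Outcome (U₁ U₂ Y₁ Y₂ : Type*) (K N : ℕ) : Type _ :=
  ((Fin K → U₁) × (Fin K → U₂)) × ((Fin N → Y₁) × (Fin N → Y₂))

section Transmission

variable {U₁ U₂ X₁ X₂ Y₁ Y₂ : Type*} {K N : ℕ}

/-- The pair of channel inputs at time `n`. -/
def TWC.Code.input (c : TWC.Code U₁ U₂ X₁ X₂ Y₁ Y₂ K N) (ω : TWC.Outcome U₁ U₂ Y₁ Y₂ K N)
    (n : Fin N) : X₁ × X₂ :=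
  (c.enc₁ n ω.1.1 (TWC.past ω.2.1 n), c.enc₂ n ω.1.2 (TWC.past ω.2.2 n))

/-- The probability of an outcome: the source pairs are i.i.d. with distribution `ps`, and the
channel `W` is memoryless. -/
def TWC.Code.prob (c : TWC.Code U₁ U₂ X₁ X₂ Y₁ Y₂ K N) (ps : U₁ × U₂ → ℝ)
    (W : X₁ × X₂ → Y₁ × Y₂ → ℝ) (ω : TWC.Outcome U₁ U₂ Y₁ Y₂ K N) : ℝ :=
  (∏ m : Fin K, ps (ω.1.1 m, ω.1.2 m)) * ∏ n : Fin N, W (c.input ω n) (ω.2.1 n, ω.2.2 n)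

/-- The distortion between two sequences of length `K`. -/
def TWC.seqDistortion {U : Type*} (d : U → U → ℝ) (u v : Fin K → U) : ℝ :=
  (K : ℝ)⁻¹ * ∑ m : Fin K, d (u m) (v m)

variable [Fintype U₁] [Fintype U₂] [Fintype Y₁] [Fintype Y₂]

/-- The expected distortion of the estimate of the first source at terminal 2. -/
def TWC.Code.distortion₁ (c : TWC.Code U₁ U₂ X₁ X₂ Y₁ Y₂ K N) (ps : U₁ × U₂ → ℝ)
    (W : X₁ × X₂ → Y₁ × Y₂ → ℝ) (d₁ : U₁ → U₁ → ℝ) : ℝ :=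
  ∑ ω : TWC.Outcome U₁ U₂ Y₁ Y₂ K N,
    c.prob ps W ω * TWC.seqDistortion d₁ ω.1.1 (c.dec₂ ω.1.2 ω.2.2)

/-- The expected distortion of the estimate of the second source at terminal 1. -/
def TWC.Code.distortion₂ (c : TWC.Code U₁ U₂ X₁ X₂ Y₁ Y₂ K N) (ps : U₁ × U₂ → ℝ)
    (W : X₁ × X₂ → Y₁ × Y₂ → ℝ) (d₂ : U₂ → U₂ → ℝ) : ℝ :=
  ∑ ω : TWC.Outcome U₁ U₂ Y₁ Y₂ K N,
    c.prob ps W ω * TWC.seqDistortion d₂ ω.1.2 (c.dec₁ ω.1.1 ω.2.1)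

/-- The distortion pair `(D₁, D₂)` is achievable at rate `r`: there are codes with `K` source
symbols and `N K` channel uses, for each `K`, such that `K / N K → r` and the upper limits of
the expected distortions are at most `D₁` and `D₂`. -/
def TWC.Achievable (ps : U₁ × U₂ → ℝ) (W : X₁ × X₂ → Y₁ × Y₂ → ℝ)
    (d₁ : U₁ → U₁ → ℝ) (d₂ : U₂ → U₂ → ℝ) (r D₁ D₂ : ℝ) : Prop :=
  ∃ (N : ℕ → ℕ) (c : (K : ℕ) → TWC.Code U₁ U₂ X₁ X₂ Y₁ Y₂ K (N K)),
    (∀ K, 0 < N K) ∧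
    Filter.Tendsto (fun K : ℕ => (K : ℝ) / (N K : ℝ)) Filter.atTop (nhds r) ∧
    Filter.limsup (fun K => (((c K).distortion₁ ps W d₁ : ℝ) : EReal)) Filter.atTop ≤ (D₁ : EReal) ∧
    Filter.limsup (fun K => (((c K).distortion₂ ps W d₂ : ℝ) : EReal)) Filter.atTop ≤ (D₂ : EReal)

end Transmission

end

/-! Fix a code and let `P` be its law of sources and outputs. Let `B` be the auxiliary measure that
draws `U₂` i.i.d., then `Y₂` letter by letter from `p(y₂|x₂)`, then each letter of `U₁` from the
backward conditional `p(u₁|û₁)`, and finally `Y₁` from `p(y₁|x₁,x₂,y₂)`. The backward conditional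
and `p(y₂|x₂)` come from the single-letter laws averaged over time. The order is admissible because
the estimate of `U₁` is a function of `U₂` and `Y₂`, so `B` has mass at most one
(`sum_prod_decode_le_one`).

Gibbs' inequality gives `E_P[log (P/B)] ≥ 0`. The logarithm is a sum over letters, with expectation
`K I(U₁;U₂) - K I(U₁;Û₁) + N I(X₁;Y₂|X₂)`. These informations already belong to the averaged laws,
so no convexity argument is needed (`mutualInfo_avgEstimate_le`). Exchanging the terminals gives the
other bound with the same averaged input law.

Conditional distributions and input laws range over compact simplices. Along a common convergent
subsequence, continuity of the informations and of the expected distortion yields the theorem,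
without continuity of the rate-distortion function. -/

namespace TWC

/-! ### Laws, informations and entropies on a finite space -/

section FiniteLaw

variable {Ω α β γ : Type*} [Fintype Ω] {q : Ω → ℝ}

theorem sum_law_mul [Fintype α] (q : Ω → ℝ) (X : Ω → α) (f : α → ℝ) :
    ∑ a, law q X a * f a = ∑ ω, q ω * f (X ω) := by
  classical
  simp only [law, Finset.sum_mul, ite_mul, zero_mul]
  rw [Finset.sum_comm]
  refine Finset.sum_congr rfl fun ω _ => ?_
  rw [Finset.sum_eq_single (X ω)] <;> simp +contextual [eq_comm]

theorem law_congr {q q' : Ω → ℝ} {X : Ω → α} {X' : Ω → β} {a : α} {b : β} (hq : ∀ ω, q ω = q' ω)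
    (hX : ∀ ω, X ω = a ↔ X' ω = b) : law q X a = law q' X' b := by
  refine Finset.sum_congr rfl fun ω _ => ?_
  by_cases h : X ω = a
  · simp [h, (hX ω).1 h, hq]
  · simp [h, mt (hX ω).2 h]

theorem law_nonneg (hq : ∀ ω, 0 ≤ q ω) (X : Ω → α) (a : α) : 0 ≤ law q X a :=
  Finset.sum_nonneg fun ω _ => by split_ifs <;> simp [hq]

theorem le_law (hq : ∀ ω, 0 ≤ q ω) (X : Ω → α) (ω : Ω) : q ω ≤ law q X (X ω) := by
  classical
  have := Finset.single_le_sum (f := fun ω' => if X ω' = X ω then q ω' else 0)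
    (fun ω' _ => by split_ifs <;> simp [hq]) (Finset.mem_univ ω)
  simpa [law] using this

theorem law_pos (hq : ∀ ω, 0 ≤ q ω) (X : Ω → α) {ω : Ω} (h : 0 < q ω) : 0 < law q X (X ω) :=
  h.trans_le (le_law hq X ω)

theorem sum_law [Fintype α] (q : Ω → ℝ) (X : Ω → α) : ∑ a, law q X a = ∑ ω, q ω := by
  simpa using sum_law_mul q X fun _ => 1

theorem sum_law_prod [Fintype α] (q : Ω → ℝ) (X : Ω → α) (Y : Ω → β) (b : β) :
    ∑ a, law q (fun ω => (X ω, Y ω)) (a, b) = law q Y b := by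
  classical
  simp only [law, Prod.mk.injEq]
  rw [Finset.sum_comm]
  refine Finset.sum_congr rfl fun ω _ => ?_
  rw [Finset.sum_eq_single (X ω)] <;> simp +contextual [eq_comm]

theorem law_fst [Fintype α] [Fintype β] (q : α × β → ℝ) (a : α) :
    law q Prod.fst a = ∑ b, q (a, b) := by
  rw [law, Fintype.sum_prod_type, Finset.sum_eq_single a (by simp +contextual) (by simp)]
  simp

theorem law_comp_equiv {Ω' : Type*} [Fintype Ω'] (e : Ω' ≃ Ω) (q : Ω → ℝ) (X : Ω → α) (a : α) :
    law (fun ω => q (e ω)) (fun ω => X (e ω)) a = law q X a := by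
  classical
  exact Fintype.sum_equiv e _ _ fun _ => rfl

theorem law_apply_injective (q : Ω → ℝ) {X : Ω → α} (hX : X.Injective) (ω : Ω) :
    law q X (X ω) = q ω := by
  classical
  simp [law, hX.eq_iff]

theorem continuous_law (X : Ω → α) (a : α) : Continuous fun q : Ω → ℝ => law q X a := by
  classical
  refine continuous_finsetSum _ fun ω _ => ?_
  split_ifs <;> fun_prop

theorem mutualInfo_eq_sum [Fintype α] [Fintype β] (q : Ω → ℝ) (X : Ω → α) (Y : Ω → β) :
    mutualInfo q X Y = ∑ ω, q ω * Real.log (law q (fun ω => (X ω, Y ω)) (X ω, Y ω) /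
      (law q X (X ω) * law q Y (Y ω))) := by
  rw [← sum_law_mul q (fun ω => (X ω, Y ω)) fun w =>
    Real.log (law q (fun ω => (X ω, Y ω)) w / (law q X w.1 * law q Y w.2)),
    Fintype.sum_prod_type, mutualInfo]

theorem condMutualInfo_eq_sum [Fintype α] [Fintype β] [Fintype γ] (q : Ω → ℝ) (X : Ω → α)
    (Y : Ω → β) (Z : Ω → γ) :
    condMutualInfo q X Y Z = ∑ ω, q ω *
      Real.log (law q (fun ω => (X ω, Y ω, Z ω)) (X ω, Y ω, Z ω) * law q Z (Z ω) /
      (law q (fun ω => (X ω, Z ω)) (X ω, Z ω) * law q (fun ω => (Y ω, Z ω)) (Y ω, Z ω))) := by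
  rw [← sum_law_mul q (fun ω => (X ω, Y ω, Z ω)) fun w =>
    Real.log (law q (fun ω => (X ω, Y ω, Z ω)) w * law q Z w.2.2 /
      (law q (fun ω => (X ω, Z ω)) (w.1, w.2.2) * law q (fun ω => (Y ω, Z ω)) (w.2.1, w.2.2))),
    Fintype.sum_prod_type, condMutualInfo]
  simp only [Fintype.sum_prod_type]

/-- The entropy of a finite-valued random variable. -/
noncomputable def entropy [Fintype α] (q : Ω → ℝ) (X : Ω → α) : ℝ := ∑ a, Real.negMulLog (law q X a)

theorem continuous_entropy [Fintype α] (X : Ω → α) : Continuous fun q : Ω → ℝ => entropy q X :=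
  continuous_finsetSum _ fun a _ => Real.continuous_negMulLog.comp (continuous_law X a)

theorem entropy_eq_sum [Fintype α] (q : Ω → ℝ) (X : Ω → α) :
    entropy q X = -∑ ω, q ω * Real.log (law q X (X ω)) := by
  rw [← sum_law_mul q X fun a => Real.log (law q X a), ← Finset.sum_neg_distrib]
  simp [entropy, Real.negMulLog]

/-- Used for continuity in `q`: the quotients inside the logarithms misbehave where probabilities
vanish, while `Real.negMulLog` is continuous everywhere. -/
theorem mutualInfo_eq_entropy [Fintype α] [Fintype β] (hq : ∀ ω, 0 ≤ q ω) (X : Ω → α)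
    (Y : Ω → β) :
    mutualInfo q X Y = entropy q X + entropy q Y - entropy q fun ω => (X ω, Y ω) := by
  simp only [mutualInfo_eq_sum, entropy_eq_sum, ← Finset.sum_neg_distrib,
    ← Finset.sum_add_distrib, ← Finset.sum_sub_distrib]
  refine Finset.sum_congr rfl fun ω _ => ?_
  rcases (hq ω).eq_or_lt with h | h
  · simp [← h]
  · have h₁ := law_pos hq X h
    have h₂ := law_pos hq Y h
    have h₃ := law_pos hq (fun ω => (X ω, Y ω)) h
    rw [Real.log_div h₃.ne' (mul_pos h₁ h₂).ne', Real.log_mul h₁.ne' h₂.ne']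
    ring

theorem condMutualInfo_eq_entropy [Fintype α] [Fintype β] [Fintype γ] (hq : ∀ ω, 0 ≤ q ω)
    (X : Ω → α) (Y : Ω → β) (Z : Ω → γ) :
    condMutualInfo q X Y Z = entropy q (fun ω => (X ω, Z ω)) + entropy q (fun ω => (Y ω, Z ω)) -
      entropy q (fun ω => (X ω, Y ω, Z ω)) - entropy q Z := by
  simp only [condMutualInfo_eq_sum, entropy_eq_sum, ← Finset.sum_neg_distrib,
    ← Finset.sum_add_distrib, ← Finset.sum_sub_distrib]
  refine Finset.sum_congr rfl fun ω _ => ?_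
  rcases (hq ω).eq_or_lt with h | h
  · simp [← h]
  · have h₁ := law_pos hq (fun ω => (X ω, Z ω)) h
    have h₂ := law_pos hq (fun ω => (Y ω, Z ω)) h
    have h₃ := law_pos hq (fun ω => (X ω, Y ω, Z ω)) h
    have h₄ := law_pos hq Z h
    rw [Real.log_div (mul_pos h₃ h₄).ne' (mul_pos h₁ h₂).ne', Real.log_mul h₁.ne' h₂.ne',
      Real.log_mul h₃.ne' h₄.ne']
    ring

theorem mutualInfo_swap [Fintype α] [Fintype β] (q : α × β → ℝ) :
    mutualInfo (fun w : β × α => q w.swap) Prod.fst Prod.snd =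
      mutualInfo q Prod.fst Prod.snd := by
  simp only [mutualInfo_eq_sum]
  refine Fintype.sum_equiv (Equiv.prodComm β α) _ _ fun w => ?_
  have h₁ := law_comp_equiv (Equiv.prodComm β α) q Prod.fst w.2
  have h₂ := law_comp_equiv (Equiv.prodComm β α) q Prod.snd w.1
  have h₃ := law_apply_injective q (X := fun w => (w.1, w.2)) (fun _ _ h => h) w.swap
  have h₄ := law_apply_injective (fun w : β × α => q w.swap) (X := fun w => (w.1, w.2))
    (fun _ _ h => h) w
  simp only [Equiv.prodComm_apply, Prod.fst_swap, Prod.snd_swap, Prod.mk.eta] at *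
  rw [h₁, h₂, h₃, h₄, mul_comm (law q Prod.fst w.2)]

theorem condMutualInfo_comp_equiv {Ω' : Type*} [Fintype Ω'] [Fintype α] [Fintype β] [Fintype γ]
    (e : Ω' ≃ Ω) (q : Ω → ℝ) (X : Ω → α) (Y : Ω → β) (Z : Ω → γ) :
    condMutualInfo (fun ω => q (e ω)) (fun ω => X (e ω)) (fun ω => Y (e ω)) (fun ω => Z (e ω)) =
      condMutualInfo q X Y Z := by
  simp only [condMutualInfo, law_comp_equiv e q Z, law_comp_equiv e q fun ω => (X ω, Z ω),
    law_comp_equiv e q fun ω => (Y ω, Z ω), law_comp_equiv e q fun ω => (X ω, Y ω, Z ω)]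

end FiniteLaw

/-- Gibbs' inequality. -/
theorem sum_mul_log_div_nonneg {ι : Type*} [Fintype ι] {a b : ι → ℝ} (ha : ∀ i, 0 ≤ a i)
    (hb : ∀ i, 0 < a i → 0 < b i) (hb' : ∀ i, 0 ≤ b i) (hab : ∑ i, b i ≤ ∑ i, a i) :
    0 ≤ ∑ i, a i * Real.log (a i / b i) := by
  calc (0 : ℝ) ≤ ∑ i, (a i - b i) := by rw [Finset.sum_sub_distrib]; linarith
    _ ≤ ∑ i, a i * Real.log (a i / b i) := by
      refine Finset.sum_le_sum fun i _ => ?_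
      rcases (ha i).eq_or_lt with h | h
      · simpa [← h] using hb' i
      · have hbi := hb i h
        have := Real.one_sub_inv_le_log_of_pos (div_pos h hbi)
        calc a i - b i = a i * (1 - (a i / b i)⁻¹) := by field_simp
          _ ≤ _ := mul_le_mul_of_nonneg_left this h.le

/-! ### Products of causal kernels -/

section Sequential

variable {Y : Type*} [Fintype Y]

theorem past_snoc_castSucc {Y : Type*} {N : ℕ} (y : Fin N → Y) (a : Y) (n : Fin N) :
    past (Fin.snoc y a : Fin (N + 1) → Y) n.castSucc = past y n := by
  funext j
  exact Fin.snoc_castSucc (α := fun _ => Y) a y (Fin.castLE n.isLt.le j)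

theorem past_snoc_last {Y : Type*} {N : ℕ} (y : Fin N → Y) (a : Y) :
    past (Fin.snoc y a : Fin (N + 1) → Y) (Fin.last N) = y := by
  funext j
  exact Fin.snoc_castSucc (α := fun _ => Y) a y j

/-- By causality the last letter occurs only in the last factor, so it can be summed out first. -/
theorem sum_prod_past_succ {N : ℕ} (k : (n : Fin (N + 1)) → (Fin (n : ℕ) → Y) → Y → ℝ) :
    ∑ y : Fin (N + 1) → Y, ∏ n, k n (past y n) (y n) =
      ∑ y : Fin N → Y, (∏ n : Fin N, k n.castSucc (past y n) (y n)) *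
        ∑ a, k (Fin.last N) y a := by
  rw [← (Fin.snocEquiv fun _ => Y).sum_comp, Fintype.sum_prod_type, Finset.sum_comm]
  refine Finset.sum_congr rfl fun y _ => ?_
  rw [Finset.mul_sum]
  refine Finset.sum_congr rfl fun a _ => ?_
  rw [Fin.prod_univ_castSucc]
  simp [Fin.snocEquiv, past_snoc_castSucc, past_snoc_last]

theorem sum_prod_past {N : ℕ} (k : (n : Fin N) → (Fin (n : ℕ) → Y) → Y → ℝ) (s : Fin N → ℝ)
    (hk : ∀ n h, ∑ y, k n h y = s n) :
    ∑ y : Fin N → Y, ∏ n, k n (past y n) (y n) = ∏ n, s n := by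
  induction N with
  | zero => simp
  | succ N ih =>
    have hl : ∀ y, ∑ a, k (Fin.last N) y a = s (Fin.last N) := hk _
    simp only [sum_prod_past_succ, hl]
    rw [← Finset.sum_mul, ih _ (fun n => s n.castSucc) fun n => hk n.castSucc,
      Fin.prod_univ_castSucc]

/-- The inequality suits conditional probabilities written as quotients, whose total is `0` when the
conditioning event is null. -/
theorem sum_prod_past_le_one {N : ℕ} (k : (n : Fin N) → (Fin (n : ℕ) → Y) → Y → ℝ)
    (hk₀ : ∀ n h y, 0 ≤ k n h y) (hk : ∀ n h, ∑ y, k n h y ≤ 1) :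
    ∑ y : Fin N → Y, ∏ n, k n (past y n) (y n) ≤ 1 := by
  induction N with
  | zero => simp
  | succ N ih =>
    rw [sum_prod_past_succ]
    refine le_trans (Finset.sum_le_sum fun y _ => mul_le_of_le_one_right ?_ (hk _ _))
      (ih _ (fun n => hk₀ n.castSucc) fun n => hk n.castSucc)
    exact Finset.prod_nonneg fun n _ => hk₀ n.castSucc _ _

theorem sum_prod_past_pair {Y₁ Y₂ : Type*} [Fintype Y₁] [Fintype Y₂] {N : ℕ}
    (k : (n : Fin N) → (Fin (n : ℕ) → Y₁) → (Fin (n : ℕ) → Y₂) → Y₁ × Y₂ → ℝ) (s : Fin N → ℝ)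
    (hk : ∀ n h₁ h₂, ∑ y, k n h₁ h₂ y = s n) :
    ∑ y : (Fin N → Y₁) × (Fin N → Y₂), ∏ n, k n (past y.1 n) (past y.2 n) (y.1 n, y.2 n) =
      ∏ n, s n := by
  rw [← sum_prod_past (fun n (h : Fin (n : ℕ) → Y₁ × Y₂) y =>
    k n (fun j => (h j).1) (fun j => (h j).2) y) s fun n h => hk n _ _]
  exact (Fintype.sum_equiv (Equiv.arrowProdEquivProdArrow (Fin N) (fun _ => Y₁) fun _ => Y₂)
    _ _ fun _ => rfl).symm

end Sequential

end TWC
namespace TWC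

/-! ### Single-letter laws of the channel -/

section Channel

variable {X₁ X₂ Y₁ Y₂ : Type*} [Fintype Y₁]

/-- The transition probabilities to the second output. -/
def outputProb₂ (W : X₁ × X₂ → Y₁ × Y₂ → ℝ) (x : X₁ × X₂) (b : Y₂) : ℝ := ∑ a, W x (a, b)

variable [Fintype Y₂] {p : X₁ × X₂ → ℝ} {W : X₁ × X₂ → Y₁ × Y₂ → ℝ}

theorem le_outputProb₂ (hW : ∀ x, W x ∈ stdSimplex ℝ (Y₁ × Y₂)) (x : X₁ × X₂) (y : Y₁ × Y₂) :
    W x y ≤ outputProb₂ W x y.2 :=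
  Finset.single_le_sum (f := fun a => W x (a, y.2)) (fun _ _ => (hW x).1 _) (Finset.mem_univ y.1)

theorem inputOutput_nonneg (hp : ∀ x, 0 ≤ p x) (hW : ∀ x, W x ∈ stdSimplex ℝ (Y₁ × Y₂))
    (w : (X₁ × X₂) × (Y₁ × Y₂)) : 0 ≤ inputOutput p W w :=
  mul_nonneg (hp _) ((hW _).1 _)

variable [Fintype X₁] [Fintype X₂]

theorem law_inputOutput_inputs (hW : ∀ x, W x ∈ stdSimplex ℝ (Y₁ × Y₂)) (x : X₁ × X₂) :
    law (inputOutput p W) (fun w => (w.1.1, w.1.2)) x = p x := by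
  classical
  simp only [law, inputOutput, Fintype.sum_prod_type (α₁ := X₁ × X₂)]
  rw [Finset.sum_eq_single x]
  · simp [← Finset.mul_sum, (hW x).2]
  · simp +contextual
  · simp

theorem law_inputOutput_inputs_output₂ (x : X₁ × X₂) (b : Y₂) :
    law (inputOutput p W) (fun w => (w.1.1, w.2.2, w.1.2)) (x.1, b, x.2) =
      p x * outputProb₂ W x b := by
  classical
  simp only [law, inputOutput, Fintype.sum_prod_type (α₁ := X₁ × X₂)]
  rw [Finset.sum_eq_single x]
  · simp [outputProb₂, Finset.mul_sum, Fintype.sum_prod_type]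
  · rintro ⟨a, b⟩ - h
    refine Finset.sum_eq_zero fun y _ => if_neg fun h' => h ?_
    simp only [Prod.mk.injEq] at h'
    exact Prod.ext h'.1 h'.2.2
  · simp

end Channel

/-! ### The law of a code, its time averages and the auxiliary measure -/

namespace Code

variable {U₁ U₂ X₁ X₂ Y₁ Y₂ : Type*} {K N : ℕ}
variable [Fintype U₁] [Fintype U₂] [Fintype Y₁] [Fintype Y₂]
variable (c : Code U₁ U₂ X₁ X₂ Y₁ Y₂ K N) {ps : U₁ × U₂ → ℝ} {W : X₁ × X₂ → Y₁ × Y₂ → ℝ}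

theorem prob_nonneg (hps : ps ∈ stdSimplex ℝ (U₁ × U₂)) (hW : ∀ x, W x ∈ stdSimplex ℝ (Y₁ × Y₂))
    (ω : Outcome U₁ U₂ Y₁ Y₂ K N) : 0 ≤ c.prob ps W ω :=
  mul_nonneg (Finset.prod_nonneg fun _ _ => hps.1 _) (Finset.prod_nonneg fun _ _ => (hW _).1 _)

omit [Fintype U₁] [Fintype U₂] in
theorem sum_prod_channel (hW : ∀ x, W x ∈ stdSimplex ℝ (Y₁ × Y₂))
    (u : (Fin K → U₁) × (Fin K → U₂)) :
    ∑ y : (Fin N → Y₁) × (Fin N → Y₂), ∏ n, W (c.input (u, y) n) (y.1 n, y.2 n) = 1 := by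
  refine (sum_prod_past_pair (fun n h₁ h₂ y => W (c.enc₁ n u.1 h₁, c.enc₂ n u.2 h₂) y)
    (fun _ => 1) fun n _ _ => (hW _).2).trans (by simp)

theorem sum_prob_mul_source_fun (hW : ∀ x, W x ∈ stdSimplex ℝ (Y₁ × Y₂))
    (f : (Fin K → U₁) × (Fin K → U₂) → ℝ) :
    ∑ ω, c.prob ps W ω * f ω.1 = ∑ u, (∏ m, ps (u.1 m, u.2 m)) * f u := by
  rw [Fintype.sum_prod_type]
  refine Finset.sum_congr rfl fun u _ => ?_
  have := c.sum_prod_channel hW u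
  calc _ = (∏ m, ps (u.1 m, u.2 m)) * f u *
        ∑ y : (Fin N → Y₁) × (Fin N → Y₂), ∏ n, W (c.input (u, y) n) (y.1 n, y.2 n) := by
        rw [Finset.mul_sum]
        exact Finset.sum_congr rfl fun y _ => by simp only [prob]; ring
    _ = _ := by rw [this, mul_one]

theorem sum_prob_mul_source_pair (hps : ps ∈ stdSimplex ℝ (U₁ × U₂))
    (hW : ∀ x, W x ∈ stdSimplex ℝ (Y₁ × Y₂)) (m : Fin K) (f : U₁ × U₂ → ℝ) :
    ∑ ω, c.prob ps W ω * f (ω.1.1 m, ω.1.2 m) = ∑ w, ps w * f w := by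
  rw [c.sum_prob_mul_source_fun hW fun u => f (u.1 m, u.2 m)]
  -- The test function is inserted into factor `m` only; every other factor sums to `1`.
  have h := sum_prod_past_pair (N := K) (fun n _ _ w => ps w * if n = m then f w else 1)
    (fun n => if n = m then ∑ w, ps w * f w else 1) (fun n _ _ => by
      split_ifs
      · rfl
      · simpa using hps.2)
  simpa only [Finset.prod_mul_distrib, Finset.prod_ite_eq', Finset.mem_univ, if_true] using h

theorem prob_mem_stdSimplex (hps : ps ∈ stdSimplex ℝ (U₁ × U₂))
    (hW : ∀ x, W x ∈ stdSimplex ℝ (Y₁ × Y₂)) :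
    c.prob ps W ∈ stdSimplex ℝ (Outcome U₁ U₂ Y₁ Y₂ K N) := by
  refine ⟨c.prob_nonneg hps hW, ?_⟩
  have h := c.sum_prob_mul_source_fun (ps := ps) hW fun _ => 1
  have h' := sum_prod_past_pair (N := K) (fun _ _ _ w => ps w) (fun _ => 1) fun _ _ _ => hps.2
  simpa [h'] using h

/-- Memorylessness: given the sources and the past, which fix the input at time `n`, the output has
law `W`, whatever the feedback. -/
theorem sum_prob_mul_input_output (hW : ∀ x, W x ∈ stdSimplex ℝ (Y₁ × Y₂)) (n : Fin N)
    (f : X₁ × X₂ → Y₁ × Y₂ → ℝ) :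
    ∑ ω, c.prob ps W ω * f (c.input ω n) (ω.2.1 n, ω.2.2 n) =
      ∑ ω, c.prob ps W ω * ∑ y, W (c.input ω n) y * f (c.input ω n) y := by
  rw [← sub_eq_zero, ← Finset.sum_sub_distrib, Fintype.sum_prod_type]
  refine Finset.sum_eq_zero fun u _ => ?_
  -- Factor `n` carries `f` minus its conditional mean, so it sums to `0` and annihilates the
  -- product.
  have h := sum_prod_past_pair (N := N) (fun j h₁ h₂ y => W (c.enc₁ j u.1 h₁, c.enc₂ j u.2 h₂) y *
      if j = n then f (c.enc₁ j u.1 h₁, c.enc₂ j u.2 h₂) y -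
        ∑ y', W (c.enc₁ j u.1 h₁, c.enc₂ j u.2 h₂) y' * f (c.enc₁ j u.1 h₁, c.enc₂ j u.2 h₂) y'
      else 1)
    (fun j => if j = n then 0 else 1) (fun j h₁ h₂ => by
      split_ifs
      · simp only [mul_sub, Finset.sum_sub_distrib, ← Finset.sum_mul, (hW _).2, one_mul, sub_self]
      · simpa using (hW _).2)
  simp only [Finset.prod_mul_distrib, Finset.prod_ite_eq', Finset.mem_univ, if_true] at h
  calc _ = (∏ m, ps (u.1 m, u.2 m)) * 0 := by
        rw [← h, Finset.mul_sum]
        exact Finset.sum_congr rfl fun y _ => by simp only [prob, input]; ring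
    _ = 0 := mul_zero _

/-- The law of a source letter of terminal 1 and its estimate, averaged over the letters. -/
noncomputable def avgEstimate (ps : U₁ × U₂ → ℝ) (W : X₁ × X₂ → Y₁ × Y₂ → ℝ) (w : U₁ × U₁) : ℝ :=
  (K : ℝ)⁻¹ * ∑ m, law (c.prob ps W) (fun ω => (ω.1.1 m, c.dec₂ ω.1.2 ω.2.2 m)) w

/-- The law of the channel inputs, averaged over the channel uses. -/
noncomputable def avgInput (ps : U₁ × U₂ → ℝ) (W : X₁ × X₂ → Y₁ × Y₂ → ℝ) (x : X₁ × X₂) : ℝ :=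
  (N : ℝ)⁻¹ * ∑ n, law (c.prob ps W) (fun ω => c.input ω n) x

theorem sum_avgEstimate_mul (f : U₁ × U₁ → ℝ) :
    ∑ w, c.avgEstimate ps W w * f w = (K : ℝ)⁻¹ *
      ∑ ω, c.prob ps W ω * ∑ m, f (ω.1.1 m, c.dec₂ ω.1.2 ω.2.2 m) := by
  simp only [avgEstimate, mul_assoc, ← Finset.mul_sum, Finset.sum_mul]
  rw [Finset.sum_comm]
  simp only [sum_law_mul, Finset.mul_sum]
  rw [Finset.sum_comm]

theorem sum_avgInput_mul [Fintype X₁] [Fintype X₂] (f : X₁ × X₂ → ℝ) :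
    ∑ x, c.avgInput ps W x * f x = (N : ℝ)⁻¹ * ∑ ω, c.prob ps W ω * ∑ n, f (c.input ω n) := by
  simp only [avgInput, mul_assoc, ← Finset.mul_sum, Finset.sum_mul]
  rw [Finset.sum_comm]
  simp only [sum_law_mul, Finset.mul_sum]
  rw [Finset.sum_comm]

theorem avgEstimate_nonneg (hps : ps ∈ stdSimplex ℝ (U₁ × U₂))
    (hW : ∀ x, W x ∈ stdSimplex ℝ (Y₁ × Y₂)) (w : U₁ × U₁) : 0 ≤ c.avgEstimate ps W w :=
  mul_nonneg (by positivity) (Finset.sum_nonneg fun _ _ => law_nonneg (c.prob_nonneg hps hW) _ _)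

/-- With `avgInput_pos`, this makes the auxiliary measure positive wherever the code's law is, as
Gibbs' inequality requires. -/
theorem avgEstimate_pos (hps : ps ∈ stdSimplex ℝ (U₁ × U₂))
    (hW : ∀ x, W x ∈ stdSimplex ℝ (Y₁ × Y₂)) {ω : Outcome U₁ U₂ Y₁ Y₂ K N}
    (hω : 0 < c.prob ps W ω) (m : Fin K) :
    0 < c.avgEstimate ps W (ω.1.1 m, c.dec₂ ω.1.2 ω.2.2 m) := by
  have hK : 0 < K := m.pos
  refine mul_pos (by positivity) (Finset.sum_pos'
    (fun _ _ => law_nonneg (c.prob_nonneg hps hW) _ _) ⟨m, Finset.mem_univ m, ?_⟩)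
  exact law_pos (c.prob_nonneg hps hW) (fun ω => (ω.1.1 m, c.dec₂ ω.1.2 ω.2.2 m)) hω

theorem avgInput_pos (hps : ps ∈ stdSimplex ℝ (U₁ × U₂))
    (hW : ∀ x, W x ∈ stdSimplex ℝ (Y₁ × Y₂)) {ω : Outcome U₁ U₂ Y₁ Y₂ K N}
    (hω : 0 < c.prob ps W ω) (n : Fin N) : 0 < c.avgInput ps W (c.input ω n) := by
  have hN : 0 < N := n.pos
  refine mul_pos (by positivity) (Finset.sum_pos'
    (fun _ _ => law_nonneg (c.prob_nonneg hps hW) _ _) ⟨n, Finset.mem_univ n, ?_⟩)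
  exact law_pos (c.prob_nonneg hps hW) (fun ω => c.input ω n) hω

theorem avgInput_mem_stdSimplex [Fintype X₁] [Fintype X₂] (hps : ps ∈ stdSimplex ℝ (U₁ × U₂))
    (hW : ∀ x, W x ∈ stdSimplex ℝ (Y₁ × Y₂)) (hN : 0 < N) :
    c.avgInput ps W ∈ stdSimplex ℝ (X₁ × X₂) := by
  refine ⟨fun x => mul_nonneg (by positivity)
    (Finset.sum_nonneg fun _ _ => law_nonneg (c.prob_nonneg hps hW) _ _), ?_⟩
  have h := c.sum_avgInput_mul (ps := ps) (W := W) fun _ => 1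
  have hN' : (N : ℝ) ≠ 0 := by positivity
  simpa [← Finset.sum_mul, (c.prob_mem_stdSimplex hps hW).2, hN'] using h

theorem sum_avgEstimate_right (hps : ps ∈ stdSimplex ℝ (U₁ × U₂))
    (hW : ∀ x, W x ∈ stdSimplex ℝ (Y₁ × Y₂)) (hK : 0 < K) (u : U₁) :
    ∑ v, c.avgEstimate ps W (u, v) = law ps Prod.fst u := by
  classical
  have h := c.sum_avgEstimate_mul (ps := ps) (W := W) fun w => if w.1 = u then 1 else 0
  have hm (m : Fin K) := c.sum_prob_mul_source_pair hps hW m fun w => if w.1 = u then 1 else 0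
  have hK' : (K : ℝ) ≠ 0 := by positivity
  simp only [Finset.mul_sum] at h
  rw [Finset.sum_comm (s := (Finset.univ : Finset (Outcome U₁ U₂ Y₁ Y₂ K N)))] at h
  simp only [← Finset.mul_sum, hm, Finset.sum_const, Finset.card_univ, Fintype.card_fin,
    nsmul_eq_mul, inv_mul_cancel_left₀ hK', Fintype.sum_prod_type (α₁ := U₁)] at h
  rw [Finset.sum_eq_single u (by simp +contextual) (by simp)] at h
  simpa [law_fst] using h

/-- A sub-probability measure on the outcomes: `U₂` is drawn first, then the outputs at terminal 2,
then `U₁` given its estimate, and then the outputs at terminal 1. -/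
theorem sum_prod_decode_le_one {G : U₁ → U₁ → ℝ} {p₂ : U₂ → ℝ} {V : X₁ × X₂ → Y₁ × Y₂ → ℝ}
    {Q : Y₂ → X₂ → ℝ} (hG₀ : ∀ u v, 0 ≤ G u v) (hG : ∀ v, ∑ u, G u v ≤ 1) (hp₂ : ∀ u, 0 ≤ p₂ u)
    (hp₂' : ∑ u, p₂ u ≤ 1) (hV₀ : ∀ x y, 0 ≤ V x y) (hV : ∀ x b, ∑ a, V x (a, b) ≤ 1)
    (hQ₀ : ∀ b x, 0 ≤ Q b x) (hQ : ∀ x, ∑ b, Q b x ≤ 1) :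
    ∑ ω : Outcome U₁ U₂ Y₁ Y₂ K N,
      (∏ m, G (ω.1.1 m) (c.dec₂ ω.1.2 ω.2.2 m) * p₂ (ω.1.2 m)) *
        ∏ n, V (c.input ω n) (ω.2.1 n, ω.2.2 n) * Q (ω.2.2 n) (c.input ω n).2 ≤ 1 := by
  have h₁ (u₁ : Fin K → U₁) (u₂ : Fin K → U₂) (y₂ : Fin N → Y₂) :
      ∑ y₁ : Fin N → Y₁, ∏ n, V (c.input ((u₁, u₂), (y₁, y₂)) n) (y₁ n, y₂ n) ≤ 1 :=
    sum_prod_past_le_one (fun n h y => V (c.enc₁ n u₁ h, c.enc₂ n u₂ (past y₂ n)) (y, y₂ n))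
      (fun _ _ _ => hV₀ _ _) fun _ _ => hV _ _
  have h₂ (v : Fin K → U₁) : ∑ u : Fin K → U₁, ∏ m, G (u m) (v m) ≤ 1 :=
    sum_prod_past_le_one (fun m _ u => G u (v m)) (fun _ _ _ => hG₀ _ _) fun _ _ => hG _
  have h₃ (u₂ : Fin K → U₂) :
      ∑ y : Fin N → Y₂, ∏ n, Q (y n) (c.enc₂ n u₂ (past y n)) ≤ 1 :=
    sum_prod_past_le_one (fun n h y => Q y (c.enc₂ n u₂ h)) (fun _ _ _ => hQ₀ _ _) fun _ _ => hQ _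
  have h₄ : ∑ u : Fin K → U₂, ∏ m, p₂ (u m) ≤ 1 :=
    sum_prod_past_le_one (fun _ _ u => p₂ u) (fun _ _ _ => hp₂ _) fun _ _ => hp₂'
  have n₂ (u v : Fin K → U₁) : 0 ≤ ∏ m, G (u m) (v m) := Finset.prod_nonneg fun _ _ => hG₀ _ _
  have n₃ (u : Fin K → U₂) (y : Fin N → Y₂) : 0 ≤ ∏ n, Q (y n) (c.enc₂ n u (past y n)) :=
    Finset.prod_nonneg fun _ _ => hQ₀ _ _
  have n₄ (u : Fin K → U₂) : 0 ≤ ∏ m, p₂ (u m) := Finset.prod_nonneg fun _ _ => hp₂ _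
  -- In this order the estimate `c.dec₂ u₂ y₂` is fixed before `u₁` is summed, and each inner sum is
  -- at most `1`.
  calc _ = ∑ u₂ : Fin K → U₂, (∏ m, p₂ (u₂ m)) *
        ∑ y₂ : Fin N → Y₂, (∏ n, Q (y₂ n) (c.enc₂ n u₂ (past y₂ n))) *
        ∑ u₁ : Fin K → U₁, (∏ m, G (u₁ m) (c.dec₂ u₂ y₂ m)) *
        ∑ y₁ : Fin N → Y₁, ∏ n, V (c.input ((u₁, u₂), (y₁, y₂)) n) (y₁ n, y₂ n) := by
        simp only [Fintype.sum_prod_type, Finset.mul_sum]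
        rw [Finset.sum_comm]
        refine Finset.sum_congr rfl fun u₂ _ => ?_
        rw [Finset.sum_comm' (t' := Finset.univ) (s' := fun _ => Finset.univ) (by simp)]
        rw [Finset.sum_congr rfl fun y₁ _ => Finset.sum_comm, Finset.sum_comm]
        refine Finset.sum_congr rfl fun y₂ _ => ?_
        rw [Finset.sum_comm]
        refine Finset.sum_congr rfl fun u₁ _ => Finset.sum_congr rfl fun y₁ _ => ?_
        simp only [Finset.prod_mul_distrib, input]
        ring
    _ ≤ 1 := by
        refine le_trans (Finset.sum_le_sum fun u₂ _ => mul_le_of_le_one_right (n₄ _) ?_) h₄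
        refine le_trans (Finset.sum_le_sum fun y₂ _ => mul_le_of_le_one_right (n₃ _ _) ?_) (h₃ u₂)
        exact le_trans (Finset.sum_le_sum fun u₁ _ => mul_le_of_le_one_right (n₂ _ _) (h₁ _ _ _))
          (h₂ _)

end Code
end TWC
-- The single-letter converse bound
namespace TWC
namespace Code

variable {U₁ U₂ X₁ X₂ Y₁ Y₂ : Type*} {K N : ℕ}
variable [Fintype U₁] [Fintype U₂] [Fintype X₁] [Fintype X₂] [Fintype Y₁] [Fintype Y₂]
variable (c : Code U₁ U₂ X₁ X₂ Y₁ Y₂ K N) {ps : U₁ × U₂ → ℝ} {W : X₁ × X₂ → Y₁ × Y₂ → ℝ}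

/-- The single-letter bound for the estimate of the first source. -/
theorem mutualInfo_avgEstimate_le (hps : ps ∈ stdSimplex ℝ (U₁ × U₂))
    (hW : ∀ x, W x ∈ stdSimplex ℝ (Y₁ × Y₂)) (hK : 0 < K) (hN : 0 < N) :
    mutualInfo (c.avgEstimate ps W) Prod.fst Prod.snd ≤
      mutualInfo ps Prod.fst Prod.snd + (N : ℝ) / K *
        condMutualInfo (inputOutput (c.avgInput ps W) W)
          (fun w => w.1.1) (fun w => w.2.2) (fun w => w.1.2) := by
  have hP := c.prob_mem_stdSimplex hps hW
  have hJ₀ := c.avgEstimate_nonneg hps hW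
  have hJpos {ω} (hω : 0 < c.prob ps W ω) := c.avgEstimate_pos hps hW hω
  have hp₀ := (c.avgInput_mem_stdSimplex hps hW hN).1
  have hppos {ω} (hω : 0 < c.prob ps W ω) := c.avgInput_pos hps hW hω
  have hJ₁ (u : U₁) : law (c.avgEstimate ps W) Prod.fst u = law ps Prod.fst u := by
    rw [law_fst, c.sum_avgEstimate_right hps hW hK]
  have hEJ := c.sum_avgEstimate_mul (ps := ps) (W := W)
  have hEp := c.sum_avgInput_mul (ps := ps) (W := W)
  set J := c.avgEstimate ps W
  set p := c.avgInput ps W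
  set q := inputOutput p W with hq
  have hq₀ : ∀ w, 0 ≤ q w := inputOutput_nonneg hp₀ hW
  rw [mutualInfo_eq_sum, mutualInfo_eq_sum, condMutualInfo_eq_sum]
  set iJ : U₁ × U₁ → ℝ := fun w =>
    Real.log (law J (fun w => (w.1, w.2)) (w.1, w.2) / (law J Prod.fst w.1 * law J Prod.snd w.2))
    with hiJ
  set iU : U₁ × U₂ → ℝ := fun w =>
    Real.log (law ps (fun w => (w.1, w.2)) (w.1, w.2) /
      (law ps Prod.fst w.1 * law ps Prod.snd w.2)) with hiU
  set iX : (X₁ × X₂) × (Y₁ × Y₂) → ℝ := fun w =>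
    Real.log (law q (fun w => (w.1.1, w.2.2, w.1.2)) (w.1.1, w.2.2, w.1.2) *
      law q (fun w => w.1.2) w.1.2 /
      (law q (fun w => (w.1.1, w.1.2)) (w.1.1, w.1.2) *
        law q (fun w => (w.2.2, w.1.2)) (w.2.2, w.1.2))) with hiX
  have hK' : (0 : ℝ) < K := by positivity
  have hN' : (0 : ℝ) < N := by positivity
  have eU : ∑ ω, c.prob ps W ω * ∑ m, iU (ω.1.1 m, ω.1.2 m) = K * ∑ w, ps w * iU w := by
    simp only [Finset.mul_sum]
    rw [Finset.sum_comm]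
    simp [c.sum_prob_mul_source_pair hps hW, Finset.mul_sum]
  have eJ : ∑ ω, c.prob ps W ω * ∑ m, iJ (ω.1.1 m, c.dec₂ ω.1.2 ω.2.2 m) =
      K * ∑ w, J w * iJ w := by
    rw [hEJ, mul_inv_cancel_left₀ hK'.ne']
  -- Averaging each output given its input, then the inputs over time, produces the law `q`.
  have eX : ∑ ω, c.prob ps W ω * ∑ n, iX (c.input ω n, (ω.2.1 n, ω.2.2 n)) =
      N * ∑ w, q w * iX w := by
    calc _ = ∑ n, ∑ ω, c.prob ps W ω * iX (c.input ω n, (ω.2.1 n, ω.2.2 n)) := by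
          simp only [Finset.mul_sum]
          rw [Finset.sum_comm]
      _ = ∑ n, ∑ ω, c.prob ps W ω * ∑ y, W (c.input ω n) y * iX (c.input ω n, y) :=
          Finset.sum_congr rfl fun n _ => c.sum_prob_mul_input_output hW n fun x y => iX (x, y)
      _ = N * ∑ x, p x * ∑ y, W x y * iX (x, y) := by
          rw [hEp, mul_inv_cancel_left₀ hN'.ne', Finset.sum_comm]
          simp only [Finset.mul_sum]
      _ = _ := by
          simp only [Fintype.sum_prod_type (α₁ := X₁ × X₂), hq, inputOutput, mul_assoc,
            Finset.mul_sum]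
  -- `G`, `V` and `Q` play the roles of `p(u₁|û₁)`, `p(y₁|x₁,x₂,y₂)` and `p(y₂|x₂)`.
  set G : U₁ → U₁ → ℝ := fun u v => law J (fun w => (w.1, w.2)) (u, v) / law J Prod.snd v with hG
  set V : X₁ × X₂ → Y₁ × Y₂ → ℝ := fun x y => W x y / outputProb₂ W x y.2 with hV
  set Q : Y₂ → X₂ → ℝ := fun b x =>
    law q (fun w => (w.2.2, w.1.2)) (b, x) / law q (fun w => w.1.2) x with hQ
  set B : Outcome U₁ U₂ Y₁ Y₂ K N → ℝ := fun ω =>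
    (∏ m, G (ω.1.1 m) (c.dec₂ ω.1.2 ω.2.2 m) * law ps Prod.snd (ω.1.2 m)) *
      ∏ n, V (c.input ω n) (ω.2.1 n, ω.2.2 n) * Q (ω.2.2 n) (c.input ω n).2 with hB
  have hG₀ (u v) : 0 ≤ G u v := div_nonneg (law_nonneg hJ₀ _ _) (law_nonneg hJ₀ _ _)
  have hp₂ (u) : 0 ≤ law ps Prod.snd u := law_nonneg hps.1 _ _
  have hV₀ (x y) : 0 ≤ V x y :=
    div_nonneg ((hW x).1 y) (((hW x).1 y).trans (le_outputProb₂ hW x y))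
  have hQ₀ (b x) : 0 ≤ Q b x := div_nonneg (law_nonneg hq₀ _ _) (law_nonneg hq₀ _ _)
  have hB₁ : ∑ ω, B ω ≤ 1 := by
    refine c.sum_prod_decode_le_one hG₀ (fun v => ?_) hp₂ ?_ hV₀ (fun x b => ?_) hQ₀ fun x => ?_
    · rw [← Finset.sum_div, sum_law_prod]
      -- Only an inequality, because `0 / 0 = 0` at values of probability zero.
      exact div_self_le_one _
    · rw [sum_law, hps.2]
    · simp only [hV]
      rw [← Finset.sum_div]
      exact div_self_le_one _
    · rw [← Finset.sum_div, sum_law_prod]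
      exact div_self_le_one _
  have hB₀ (ω) : 0 ≤ B ω := mul_nonneg
    (Finset.prod_nonneg fun _ _ => mul_nonneg (hG₀ _ _) (hp₂ _))
    (Finset.prod_nonneg fun _ _ => mul_nonneg (hV₀ _ _) (hQ₀ _ _))
  have hsource {ω} (hω : 0 < c.prob ps W ω) (m) : 0 < ps (ω.1.1 m, ω.1.2 m) :=
    (hps.1 _).lt_of_ne' (Finset.prod_ne_zero_iff.1 (left_ne_zero_of_mul hω.ne') m
      (Finset.mem_univ m))
  have hchannel {ω} (hω : 0 < c.prob ps W ω) (n) : 0 < W (c.input ω n) (ω.2.1 n, ω.2.2 n) :=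
    ((hW _).1 _).lt_of_ne' (Finset.prod_ne_zero_iff.1 (right_ne_zero_of_mul hω.ne') n
      (Finset.mem_univ n))
  have hm {ω} (hω : 0 < c.prob ps W ω) (m) :
      0 < G (ω.1.1 m) (c.dec₂ ω.1.2 ω.2.2 m) * law ps Prod.snd (ω.1.2 m) ∧
      Real.log (ps (ω.1.1 m, ω.1.2 m) /
        (G (ω.1.1 m) (c.dec₂ ω.1.2 ω.2.2 m) * law ps Prod.snd (ω.1.2 m))) =
      iU (ω.1.1 m, ω.1.2 m) - iJ (ω.1.1 m, c.dec₂ ω.1.2 ω.2.2 m) := by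
    have a₀ := hsource hω m
    have a₁ := law_pos hps.1 Prod.fst a₀
    have a₂ := law_pos hps.1 Prod.snd a₀
    have b₀ := law_pos hJ₀ (fun w => (w.1, w.2)) (hJpos hω m)
    have b₂ := law_pos hJ₀ Prod.snd (hJpos hω m)
    have a₃ := law_apply_injective ps (X := fun w => (w.1, w.2)) (fun _ _ h => h)
      (ω.1.1 m, ω.1.2 m)
    dsimp only at a₁ a₂ b₀ b₂ a₃
    refine ⟨mul_pos (div_pos b₀ b₂) a₂, ?_⟩
    -- By `hJ₁` the first marginal of `J` is the law of `U₁`, so it cancels between the two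
    -- densities.
    simp only [hiU, hiJ, hJ₁, hG]
    rw [a₃, ← Real.log_div (by positivity) (by positivity)]
    congr 1
    field_simp
  have hn {ω} (hω : 0 < c.prob ps W ω) (n) :
      0 < V (c.input ω n) (ω.2.1 n, ω.2.2 n) * Q (ω.2.2 n) (c.input ω n).2 ∧
      Real.log (W (c.input ω n) (ω.2.1 n, ω.2.2 n) /
        (V (c.input ω n) (ω.2.1 n, ω.2.2 n) * Q (ω.2.2 n) (c.input ω n).2)) =
      iX (c.input ω n, (ω.2.1 n, ω.2.2 n)) := by
    have a₀ := hchannel hω n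
    have a₁ := a₀.trans_le (le_outputProb₂ hW _ _)
    have a₂ := hppos hω n
    have a₃ : 0 < q (c.input ω n, (ω.2.1 n, ω.2.2 n)) := mul_pos a₂ a₀
    have b₁ := law_pos hq₀ (fun w => (w.2.2, w.1.2)) a₃
    have b₂ := law_pos hq₀ (fun w => w.1.2) a₃
    have b₃ := law_inputOutput_inputs (p := p) hW (c.input ω n)
    have b₄ := law_inputOutput_inputs_output₂ (p := p) (W := W) (c.input ω n) (ω.2.2 n)
    dsimp only at a₁ b₁ b₂
    refine ⟨mul_pos (div_pos a₀ a₁) (div_pos b₁ b₂), ?_⟩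
    simp only [hiX, hV, hQ]
    -- Both sides reduce to `log (p(y₂|x₁,x₂) / p(y₂|x₂))`: on the left `W` cancels, on the right
    -- the input probability.
    rw [b₄, show law q (fun w => (w.1.1, w.1.2)) ((c.input ω n).1, (c.input ω n).2) = _ from b₃]
    congr 1
    field_simp
  have hBpos (ω) (hω : 0 < c.prob ps W ω) : 0 < B ω :=
    mul_pos (Finset.prod_pos fun m _ => (hm hω m).1) (Finset.prod_pos fun n _ => (hn hω n).1)
  have hlog (ω) : c.prob ps W ω * Real.log (c.prob ps W ω / B ω) = c.prob ps W ω *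
      (∑ m, iU (ω.1.1 m, ω.1.2 m) - ∑ m, iJ (ω.1.1 m, c.dec₂ ω.1.2 ω.2.2 m) +
        ∑ n, iX (c.input ω n, (ω.2.1 n, ω.2.2 n))) := by
    rcases (hP.1 ω).eq_or_lt with h | h
    · simp [← h]
    · have hs : ∏ m, ps (ω.1.1 m, ω.1.2 m) / (G (ω.1.1 m) (c.dec₂ ω.1.2 ω.2.2 m) *
          law ps Prod.snd (ω.1.2 m)) ≠ 0 :=
        Finset.prod_ne_zero_iff.2 fun m _ => (div_pos (hsource h m) (hm h m).1).ne'
      have hc : ∏ n, W (c.input ω n) (ω.2.1 n, ω.2.2 n) / (V (c.input ω n) (ω.2.1 n, ω.2.2 n) *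
          Q (ω.2.2 n) (c.input ω n).2) ≠ 0 :=
        Finset.prod_ne_zero_iff.2 fun n _ => (div_pos (hchannel h n) (hn h n).1).ne'
      rw [hB, prob, mul_div_mul_comm, ← Finset.prod_div_distrib, ← Finset.prod_div_distrib,
        Real.log_mul hs hc, Real.log_prod (Finset.prod_ne_zero_iff.1 hs),
        Real.log_prod (Finset.prod_ne_zero_iff.1 hc), ← Finset.sum_sub_distrib]
      simp only [(hm h _).2, (hn h _).2]
  have key := sum_mul_log_div_nonneg hP.1 hBpos hB₀ (hB₁.trans_eq hP.2.symm)
  simp only [hlog, mul_add, mul_sub, Finset.sum_add_distrib, Finset.sum_sub_distrib] at key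
  rw [eU, eJ, eX] at key
  refine le_of_mul_le_mul_left ?_ hK'
  have : (K : ℝ) * (∑ w, ps w * iU w + N / K * ∑ w, q w * iX w) =
      K * ∑ w, ps w * iU w + N * ∑ w, q w * iX w := by field_simp
  rw [this]
  linarith

omit [Fintype X₁] [Fintype X₂] in
theorem sum_avgEstimate_mul_distortion (d₁ : U₁ → U₁ → ℝ) :
    ∑ w, c.avgEstimate ps W w * d₁ w.1 w.2 = c.distortion₁ ps W d₁ := by
  rw [c.sum_avgEstimate_mul (fun w => d₁ w.1 w.2), Finset.mul_sum]
  exact Finset.sum_congr rfl fun ω _ => by simp only [seqDistortion]; ring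

/-- The averaged law of a source letter and its estimate as a conditional distribution. -/
theorem exists_conditional (hps : ps ∈ stdSimplex ℝ (U₁ × U₂))
    (hW : ∀ x, W x ∈ stdSimplex ℝ (Y₁ × Y₂)) (hK : 0 < K) (hN : 0 < N) (d₁ : U₁ → U₁ → ℝ) :
    ∃ V : U₁ → U₁ → ℝ, (∀ u, V u ∈ stdSimplex ℝ U₁) ∧
      ∑ u, ∑ v, law ps Prod.fst u * V u v * d₁ u v = c.distortion₁ ps W d₁ ∧
      mutualInfo (fun w : U₁ × U₁ => law ps Prod.fst w.1 * V w.1 w.2) Prod.fst Prod.snd ≤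
        mutualInfo ps Prod.fst Prod.snd + (N : ℝ) / K *
          condMutualInfo (inputOutput (c.avgInput ps W) W)
            (fun w => w.1.1) (fun w => w.2.2) (fun w => w.1.2) := by
  classical
  have hJ₀ := c.avgEstimate_nonneg hps hW
  have hJ := c.sum_avgEstimate_right hps hW hK
  -- On letters of probability zero any distribution serves; a point mass keeps `V u` in the
  -- simplex.
  set V : U₁ → U₁ → ℝ := fun u v => if law ps Prod.fst u = 0 then (Pi.single u 1 : U₁ → ℝ) v else
    c.avgEstimate ps W (u, v) / law ps Prod.fst u with hV
  have hVJ (w : U₁ × U₁) : law ps Prod.fst w.1 * V w.1 w.2 = c.avgEstimate ps W w := by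
    by_cases h : law ps Prod.fst w.1 = 0
    · have := (Finset.sum_eq_zero_iff_of_nonneg fun v _ => hJ₀ (w.1, v)).1 ((hJ w.1).trans h) w.2
        (Finset.mem_univ _)
      rw [h, zero_mul]
      exact this.symm
    · simp only [hV, if_neg h]
      field_simp
  refine ⟨V, fun u => ?_, ?_, ?_⟩
  · by_cases h : law ps Prod.fst u = 0
    · simpa only [hV, if_pos h] using single_mem_stdSimplex ℝ u
    · simp only [hV, if_neg h]
      refine ⟨fun v => div_nonneg (hJ₀ _) (law_nonneg hps.1 _ _), ?_⟩
      rw [← Finset.sum_div, hJ, div_self h]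
  · rw [← c.sum_avgEstimate_mul_distortion, Fintype.sum_prod_type]
    simp only [← hVJ]
  · simp only [hVJ]
    exact c.mutualInfo_avgEstimate_le hps hW hK hN

end Code
end TWC
open Filter Topology

namespace TWC
namespace Code

/-! ### Exchange of the terminals -/

variable {U₁ U₂ X₁ X₂ Y₁ Y₂ : Type*} {K N : ℕ}

/-- The code with the roles of the terminals exchanged. -/
def swap (c : Code U₁ U₂ X₁ X₂ Y₁ Y₂ K N) : Code U₂ U₁ X₂ X₁ Y₂ Y₁ K N :=
  ⟨c.enc₂, c.enc₁, c.dec₂, c.dec₁⟩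

/-- Exchanging the roles of the terminals in an outcome. -/
def swapOutcome (U₁ U₂ Y₁ Y₂ : Type*) (K N : ℕ) :
    Outcome U₂ U₁ Y₂ Y₁ K N ≃ Outcome U₁ U₂ Y₁ Y₂ K N :=
  (Equiv.prodComm _ _).prodCongr (Equiv.prodComm _ _)

variable [Fintype U₁] [Fintype U₂] [Fintype X₁] [Fintype X₂] [Fintype Y₁] [Fintype Y₂]
variable (c : Code U₁ U₂ X₁ X₂ Y₁ Y₂ K N) {ps : U₁ × U₂ → ℝ} {W : X₁ × X₂ → Y₁ × Y₂ → ℝ}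

omit [Fintype X₁] [Fintype X₂] in
theorem swap_distortion₁ (d₂ : U₂ → U₂ → ℝ) :
    c.swap.distortion₁ (fun w => ps w.swap) (fun x y => W x.swap y.swap) d₂ =
      c.distortion₂ ps W d₂ :=
  Fintype.sum_equiv (swapOutcome U₁ U₂ Y₁ Y₂ K N) _ _ fun _ => rfl

omit [Fintype X₁] [Fintype X₂] in
-- This is why one input distribution serves both bounds.
theorem swap_avgInput (x : X₂ × X₁) :
    c.swap.avgInput (fun w => ps w.swap) (fun x y => W x.swap y.swap) x =
      c.avgInput ps W x.swap := by
  unfold avgInput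
  congr 1
  refine Finset.sum_congr rfl fun n _ => ?_
  have h := law_comp_equiv (swapOutcome U₁ U₂ Y₁ Y₂ K N) (c.prob ps W)
    (fun ω => c.input ω n) x.swap
  rw [← h]
  exact law_congr (fun ω => rfl) fun ω =>
    Prod.swap_eq_iff_eq_swap (x := c.input (swapOutcome U₁ U₂ Y₁ Y₂ K N ω) n)

theorem exists_conditional_swap (hps : ps ∈ stdSimplex ℝ (U₁ × U₂))
    (hW : ∀ x, W x ∈ stdSimplex ℝ (Y₁ × Y₂)) (hK : 0 < K) (hN : 0 < N) (d₂ : U₂ → U₂ → ℝ) :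
    ∃ V : U₂ → U₂ → ℝ, (∀ u, V u ∈ stdSimplex ℝ U₂) ∧
      ∑ u, ∑ v, law ps Prod.snd u * V u v * d₂ u v = c.distortion₂ ps W d₂ ∧
      mutualInfo (fun w : U₂ × U₂ => law ps Prod.snd w.1 * V w.1 w.2) Prod.fst Prod.snd ≤
        mutualInfo ps Prod.fst Prod.snd + (N : ℝ) / K *
          condMutualInfo (inputOutput (c.avgInput ps W) W)
            (fun w => w.1.2) (fun w => w.2.1) (fun w => w.1.1) := by
  have hps' : (fun w : U₂ × U₁ => ps w.swap) ∈ stdSimplex ℝ (U₂ × U₁) :=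
    ⟨fun w => hps.1 _, ((Equiv.prodComm U₂ U₁).sum_comp ps).trans hps.2⟩
  have hW' (x : X₂ × X₁) : (fun y : Y₂ × Y₁ => W x.swap y.swap) ∈ stdSimplex ℝ (Y₂ × Y₁) :=
    ⟨fun y => (hW _).1 _, ((Equiv.prodComm Y₂ Y₁).sum_comp (W x.swap)).trans (hW _).2⟩
  obtain ⟨V, hV, h₁, h₂⟩ := c.swap.exists_conditional hps' hW' hK hN d₂
  have hfst (u : U₂) : law (fun w : U₂ × U₁ => ps w.swap) Prod.fst u = law ps Prod.snd u :=
    law_comp_equiv (Equiv.prodComm U₂ U₁) ps Prod.snd u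
  have hc := condMutualInfo_comp_equiv
    ((Equiv.prodComm X₂ X₁).prodCongr (Equiv.prodComm Y₂ Y₁)) (inputOutput (c.avgInput ps W) W)
    (fun w => w.1.2) (fun w => w.2.1) (fun w => w.1.1)
  rw [swap_distortion₁] at h₁
  simp only [hfst] at h₁ h₂
  rw [mutualInfo_swap, funext c.swap_avgInput] at h₂
  exact ⟨V, hV, h₁, h₂.trans_eq (by rw [← hc]; rfl)⟩

end Code

/-! ### Continuity and passage to the limit -/

theorem continuousOn_mutualInfo {Ω α β : Type*} [Fintype Ω] [Fintype α] [Fintype β]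
    (X : Ω → α) (Y : Ω → β) :
    ContinuousOn (fun q : Ω → ℝ => mutualInfo q X Y) {q | ∀ ω, 0 ≤ q ω} :=
  (((continuous_entropy X).add (continuous_entropy Y)).sub
    (continuous_entropy _)).continuousOn.congr fun _ hq => mutualInfo_eq_entropy hq X Y

theorem continuousOn_condMutualInfo {Ω α β γ : Type*} [Fintype Ω] [Fintype α] [Fintype β]
    [Fintype γ] (X : Ω → α) (Y : Ω → β) (Z : Ω → γ) :
    ContinuousOn (fun q : Ω → ℝ => condMutualInfo q X Y Z) {q | ∀ ω, 0 ≤ q ω} :=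
  ((((continuous_entropy _).add (continuous_entropy _)).sub (continuous_entropy _)).sub
    (continuous_entropy Z)).continuousOn.congr fun _ hq => condMutualInfo_eq_entropy hq X Y Z

theorem rateDistortion_le {U : Type*} [Fintype U] {pU : U → ℝ} {d : U → U → ℝ} {D : ℝ}
    {V : U → U → ℝ} (hV : ∀ u, V u ∈ stdSimplex ℝ U)
    (hD : ∑ u, ∑ v, pU u * V u v * d u v ≤ D) {b : ℝ}
    (hb : mutualInfo (fun w : U × U => pU w.1 * V w.1 w.2) Prod.fst Prod.snd ≤ b) :
    rateDistortion pU d D ≤ b :=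
  iInf_le_of_le V (iInf_le_of_le hV (iInf_le_of_le hD (EReal.coe_le_coe_iff.2 hb)))

/-- A limit of conditional distributions witnesses the limit of rate bounds. -/
theorem rateDistortion_le_of_tendsto {U : Type*} [Fintype U] {pU : U → ℝ} (hpU : ∀ u, 0 ≤ pU u)
    {d : U → U → ℝ} {D b : ℝ} {V : ℕ → U → U → ℝ} {V' : U → U → ℝ} {δ β : ℕ → ℝ}
    (hV : ∀ k u, V k u ∈ stdSimplex ℝ U) (hV' : ∀ u, V' u ∈ stdSimplex ℝ U)
    (hlim : Tendsto V atTop (𝓝 V'))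
    (hδ : ∀ k, ∑ u, ∑ v, pU u * V k u v * d u v = δ k)
    (hδD : limsup (fun k => (δ k : EReal)) atTop ≤ D)
    (hβ : ∀ k, mutualInfo (fun w : U × U => pU w.1 * V k w.1 w.2) Prod.fst Prod.snd ≤ β k)
    (hβb : Tendsto β atTop (𝓝 b)) : rateDistortion pU d D ≤ b := by
  refine rateDistortion_le hV' ?_ ?_
  · have hcont : Continuous fun V : U → U → ℝ => ∑ u, ∑ v, pU u * V u v * d u v := by fun_prop
    have ht : Tendsto δ atTop (𝓝 (∑ u, ∑ v, pU u * V' u v * d u v)) := by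
      simpa only [← funext hδ, Function.comp_def] using (hcont.tendsto V').comp hlim
    -- The distortions converge, so their limit equals their limsup and the limiting conditional
    -- meets the constraint `D` exactly.
    exact EReal.coe_le_coe_iff.1
      (((continuous_coe_real_ereal.tendsto _).comp ht).limsup_eq.symm.trans_le hδD)
  · have hcont : Continuous fun (V : U → U → ℝ) (w : U × U) => pU w.1 * V w.1 w.2 := by fun_prop
    have ht : Tendsto (fun k (w : U × U) => pU w.1 * V k w.1 w.2) atTop
        (𝓝[{q | ∀ ω, 0 ≤ q ω}] fun w => pU w.1 * V' w.1 w.2) :=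
      tendsto_nhdsWithin_iff.2 ⟨(hcont.tendsto V').comp hlim,
        Eventually.of_forall fun k w => mul_nonneg (hpU _) ((hV k _).1 _)⟩
    exact le_of_tendsto_of_tendsto' ((continuousOn_mutualInfo Prod.fst Prod.snd _
      fun w => mul_nonneg (hpU _) ((hV' _).1 _)).tendsto.comp ht) hβb hβ

theorem limsup_comp_le {f : ℕ → EReal} {φ : ℕ → ℕ} (hφ : Tendsto φ atTop atTop) :
    limsup (fun k => f (φ k)) atTop ≤ limsup f atTop :=
  limsup_le_limsup_of_le hφ

end TWC

open TWC in
theorem lemma2 {U₁ U₂ X₁ X₂ Y₁ Y₂ : Type*}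
    [Fintype U₁] [Fintype U₂] [Fintype X₁] [Fintype X₂] [Fintype Y₁] [Fintype Y₂]
    (ps : U₁ × U₂ → ℝ) (hps : ps ∈ stdSimplex ℝ (U₁ × U₂))
    (W : X₁ × X₂ → Y₁ × Y₂ → ℝ) (hW : ∀ x, W x ∈ stdSimplex ℝ (Y₁ × Y₂))
    (d₁ : U₁ → U₁ → ℝ) (d₂ : U₂ → U₂ → ℝ) (r D₁ D₂ : ℝ) (hr : 0 < r)
    (hD : TWC.Achievable ps W d₁ d₂ r D₁ D₂) :
    ∃ p ∈ stdSimplex ℝ (X₁ × X₂),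
      TWC.rateDistortion (TWC.law ps Prod.fst) d₁ D₁ ≤
        ((TWC.mutualInfo ps Prod.fst Prod.snd + r⁻¹ *
          TWC.condMutualInfo (TWC.inputOutput p W)
            (fun w => w.1.1) (fun w => w.2.2) (fun w => w.1.2) : ℝ) : EReal) ∧
      TWC.rateDistortion (TWC.law ps Prod.snd) d₂ D₂ ≤
        ((TWC.mutualInfo ps Prod.fst Prod.snd + r⁻¹ *
          TWC.condMutualInfo (TWC.inputOutput p W)
            (fun w => w.1.2) (fun w => w.2.1) (fun w => w.1.1) : ℝ) : EReal) := by
  obtain ⟨N, c, hN, hr', hD₁, hD₂⟩ := hD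
  -- The shift to `K + 1` avoids block length `0`, where the averages over letters are undefined.
  choose V₁ hV₁ hδ₁ hβ₁ using fun K =>
    (c (K + 1)).exists_conditional hps hW K.succ_pos (hN _) d₁
  choose V₂ hV₂ hδ₂ hβ₂ using fun K =>
    (c (K + 1)).exists_conditional_swap hps hW K.succ_pos (hN _) d₂
  have hp (K : ℕ) := (c (K + 1)).avgInput_mem_stdSimplex hps hW (hN _)
  have hcompact := (isCompact_stdSimplex ℝ (X₁ × X₂)).prod
    ((isCompact_univ_pi fun _ : U₁ => isCompact_stdSimplex ℝ U₁).prod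
      (isCompact_univ_pi fun _ : U₂ => isCompact_stdSimplex ℝ U₂))
  -- Compactness of the product gives one subsequence for all three objects, hence the same `p` in
  -- both bounds.
  obtain ⟨⟨p, V₁', V₂'⟩, ⟨hp', hV₁', hV₂'⟩, φ, hφ, hlim⟩ := hcompact.tendsto_subseq
    (x := fun K => ((c (K + 1)).avgInput ps W, V₁ K, V₂ K))
    fun K => ⟨hp K, fun u _ => hV₁ K u, fun u _ => hV₂ K u⟩
  have hφ' : Tendsto (fun k => φ k + 1) atTop atTop :=
    (tendsto_add_atTop_nat 1).comp hφ.tendsto_atTop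
  have hlim₁ : Tendsto (fun k => V₁ (φ k)) atTop (𝓝 V₁') := hlim.snd_nhds.fst_nhds
  have hlim₂ : Tendsto (fun k => V₂ (φ k)) atTop (𝓝 V₂') := hlim.snd_nhds.snd_nhds
  have hlimp : Tendsto (fun k => (c (φ k + 1)).avgInput ps W) atTop (𝓝 p) := hlim.fst_nhds
  have hratio : Tendsto (fun k => (N (φ k + 1) : ℝ) / ((φ k + 1 : ℕ) : ℝ)) atTop (𝓝 r⁻¹) := by
    simpa only [inv_div, Function.comp_def] using (hr'.comp hφ').inv₀ hr.ne'
  have hcont : Continuous fun p : X₁ × X₂ → ℝ => inputOutput p W := by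
    unfold inputOutput
    fun_prop
  have hio : Tendsto (fun k => inputOutput ((c (φ k + 1)).avgInput ps W) W) atTop
      (𝓝[{q | ∀ w, 0 ≤ q w}] inputOutput p W) :=
    tendsto_nhdsWithin_iff.2 ⟨(hcont.tendsto p).comp hlimp,
      Eventually.of_forall fun k => inputOutput_nonneg (hp _).1 hW⟩
  have hinfo₁ := (tendsto_const_nhds (x := mutualInfo ps Prod.fst Prod.snd)).add (hratio.mul
    ((continuousOn_condMutualInfo (fun w : (X₁ × X₂) × (Y₁ × Y₂) => w.1.1) (fun w => w.2.2)
      (fun w => w.1.2) _ (inputOutput_nonneg hp'.1 hW)).tendsto.comp hio))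
  have hinfo₂ := (tendsto_const_nhds (x := mutualInfo ps Prod.fst Prod.snd)).add (hratio.mul
    ((continuousOn_condMutualInfo (fun w : (X₁ × X₂) × (Y₁ × Y₂) => w.1.2) (fun w => w.2.1)
      (fun w => w.1.1) _ (inputOutput_nonneg hp'.1 hW)).tendsto.comp hio))
  have hlimsup₁ : limsup (fun k => (((c (φ k + 1)).distortion₁ ps W d₁ : ℝ) : EReal)) atTop ≤
      limsup (fun K => (((c K).distortion₁ ps W d₁ : ℝ) : EReal)) atTop :=
    limsup_comp_le (f := fun K => (((c K).distortion₁ ps W d₁ : ℝ) : EReal)) hφ'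
  have hlimsup₂ : limsup (fun k => (((c (φ k + 1)).distortion₂ ps W d₂ : ℝ) : EReal)) atTop ≤
      limsup (fun K => (((c K).distortion₂ ps W d₂ : ℝ) : EReal)) atTop :=
    limsup_comp_le (f := fun K => (((c K).distortion₂ ps W d₂ : ℝ) : EReal)) hφ'
  refine ⟨p, hp', ?_, ?_⟩
  · exact rateDistortion_le_of_tendsto (law_nonneg hps.1 _) (fun k => hV₁ (φ k))
      (fun u => hV₁' u trivial) hlim₁ (fun k => hδ₁ (φ k)) (hlimsup₁.trans hD₁)
      (fun k => hβ₁ (φ k)) hinfo₁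
  · exact rateDistortion_le_of_tendsto (law_nonneg hps.1 _) (fun k => hV₂ (φ k))
      (fun u => hV₂' u trivial) hlim₂ (fun k => hδ₂ (φ k)) (hlimsup₂.trans hD₂)
      (fun k => hβ₂ (φ k)) hinfo₂
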